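/- Let $\lambda,\mu,\alpha>0$. Let $\eta=(\eta(n))_{n\ge 0}$ be a Markov chain on $\mathbb Z^+=\{0,1,2,\dots\}$ with $\eta(0)=0$ and the following transition probabilities: from $0$ it moves to $1$ with probability $1$; from $i\ge 1$ it moves to $i+1$ with probability $\frac{\lambda}{\lambda+\mu}$ and to each $j\in\{0,1,\dots,i-1\}$ with probability $\frac{\mu}{i(\lambda+\mu)}$. Let $\nu=(\nu(t))_{t\ge 0}$ be a Poisson process with rate $\alpha$, independent of $\eta$, on the same probability space $(\Omega,\mathfrak F,\mathbf P)$, and let $\xi(t)=\eta(\nu(t))$, $t\ge 0$ (the Poisson process with uniform catastrophes). Let $\varphi$ be a real-valued function with $\lim_{T\to\infty}\varphi(T)/T=k$ for some $k\in(0,\infty)$, and put $\xi_T(1)=\xi(T)/\varphi(T)$ (defined for all large $T$). Define $J_k:\mathbb R\to[0,\infty]$ by $$ J_k(x)=\begin{cases} \infty, & x<0,\\ x\ln\frac{\lambda+\mu}{\lambda}, & 0\le x<\frac{\alpha}{k},\\ x\ln\frac{kx(\lambda+\mu)}{\alpha\lambda}-x+\frac{\alpha}{k}, & x\ge \frac{\alpha}{k}.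 \end{cases} $$ Then the family $\xi_T(1)$ satisfies, as $T\to\infty$, the large deviation principle on $\mathbb R$ with normalizing function $\psi(T)=\varphi(T)$ and rate function $J_k$. That is: $\varphi(T)\to\infty$ as $T\to\infty$; $J_k$ takes values in $[0,\infty]$; for every $c\ge 0$ the set $\{x\in\mathbb R: J_k(x)\le c\}$ is compact; and for every Borel set $B\subseteq\mathbb R$, with closure $[B]$ and interior $(B)$, $$ \limsup_{T\to\infty}\frac{1}{\varphi(T)}\ln\mathbf P(\xi_T(1)\in B)\le -\inf_{x\in[B]}J_k(x), \qquad \liminf_{T\to\infty}\frac{1}{\varphi(T)}\ln\mathbf P(\xi_T(1)\in B)\ge -\inf_{x\in(B)}J_k(x), $$ where $\ln 0=-\infty$ and $\inf\emptyset=\infty$. -/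

import Mathlib

open MeasureTheory ProbabilityTheory Filter Topology
open scoped NNReal ENNReal

noncomputable section

namespace UniformCatastrophes

/-- Transition probabilities on `ℕ` of the embedded jump chain: from `0` the chain moves to `1` with
probability one; from `i ≠ 0` it moves to `i + 1` with probability `lam / (lam + mu)` and to each of
`0, …, i - 1` with probability `mu / (i * (lam + mu))`. -/
def transProb (lam mu : ℝ) (i j : ℕ) : ℝ :=
  if i = 0 then (if j = 1 then 1 else 0)
  else if j = i + 1 then lam / (lam + mu)
  else if j < i then mu / (i * (lam + mu))
  else 0

/-- `η` is a Markov chain on `ℕ`, started at `0`, with transition probabilities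
`transProb lam mu`. The conditional probability given a finite past is written as a product, so
that pasts of probability zero need no special treatment. -/
structure IsJumpChain {Ω : Type*} [MeasurableSpace Ω] (P : Measure Ω) (lam mu : ℝ)
    (η : ℕ → Ω → ℕ) : Prop where
  measurable : ∀ n, Measurable (η n)
  initial : ∀ᵐ ω ∂P, η 0 ω = 0
  markov : ∀ (n : ℕ) (i : ℕ → ℕ) (j : ℕ),
    P {ω | (∀ m ≤ n, η m ω = i m) ∧ η (n + 1) ω = j} =
      P {ω | ∀ m ≤ n, η m ω = i m} * ENNReal.ofReal (transProb lam mu (i n) j)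

/-- `ν` is a (homogeneous) Poisson process of rate `α`: it starts at `0`, almost all paths are
nondecreasing and right-continuous, increments over disjoint intervals are independent, and the
increment over `[s, t]` has the Poisson law of parameter `α (t - s)`. Since almost all paths are
nondecreasing, the natural-number subtraction in the increments is the true one almost surely. -/
structure IsPoissonProcess {Ω : Type*} [MeasurableSpace Ω] (P : Measure Ω) (α : ℝ≥0)
    (ν : ℝ≥0 → Ω → ℕ) : Prop where
  measurable : ∀ t, Measurable (ν t)
  initial : ∀ᵐ ω ∂P, ν 0 ω = 0
  monotone : ∀ᵐ ω ∂P, Monotone fun t => ν t ω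
  rightCont : ∀ᵐ ω ∂P, ∀ t, ContinuousWithinAt (fun s => ν s ω) (Set.Ioi t) t
  indepIncrements : HasIndepIncrements ν P
  law : ∀ s t : ℝ≥0, s ≤ t → HasLaw (fun ω => ν t ω - ν s ω) (poissonMeasure (α * (t - s))) P

/-- The process `ξ(t) = η(ν(t))`. -/
def process {Ω : Type*} (η : ℕ → Ω → ℕ) (ν : ℝ≥0 → Ω → ℕ) (t : ℝ≥0) (ω : Ω) : ℕ :=
  η (ν t ω) ω

/-- `ξ` is a Poisson process with uniform catastrophes, with parameters `lam`, `mu`, `α`: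
`ξ(t) = η(ν(t))` where the jump chain `η` and the Poisson process `ν` are independent
(as whole processes). -/
def IsPoissonUniformCatastrophes {Ω : Type*} [MeasurableSpace Ω] (P : Measure Ω)
    (lam mu : ℝ) (α : ℝ≥0) (ξ : ℝ≥0 → Ω → ℕ) : Prop :=
  ∃ (η : ℕ → Ω → ℕ) (ν : ℝ≥0 → Ω → ℕ),
    IsJumpChain P lam mu η ∧ IsPoissonProcess P α ν ∧
    IndepFun (fun ω t => ν t ω) (fun ω n => η n ω) P ∧
    ξ = process η ν

/-- The scaled process `ξ_T(t) = ξ(T t) / φ(T)`. -/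
def scaled {Ω : Type*} (ξ : ℝ≥0 → Ω → ℕ) (φ : ℝ≥0 → ℝ) (T t : ℝ≥0) (ω : Ω) : ℝ :=
  (ξ (T * t) ω : ℝ) / φ T

/-- The large deviation principle on `ℝ`, as `T → ∞`, for a family `X T` of real random variables,
with rate function `I : ℝ → [0, ∞]` (with compact level sets) and normalizing function `ψ → ∞`.
Logarithms, upper and lower limits and infima are taken in the extended reals, with `log 0 = -∞` and
`inf ∅ = +∞`. -/
structure SatisfiesLDP {Ω : Type*} [MeasurableSpace Ω] (P : Measure Ω)
    (X : ℝ≥0 → Ω → ℝ) (ψ : ℝ≥0 → ℝ) (I : ℝ → EReal) : Prop where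
  tendsto_normalization : Tendsto ψ atTop atTop
  nonneg : ∀ x, 0 ≤ I x
  isCompact_level : ∀ c : ℝ, 0 ≤ c → IsCompact {x : ℝ | I x ≤ (c : EReal)}
  upper : ∀ B : Set ℝ, MeasurableSet B →
    limsup (fun T : ℝ≥0 => ((1 / ψ T : ℝ) : EReal) * ENNReal.log (P {ω | X T ω ∈ B})) atTop
      ≤ -(⨅ x ∈ closure B, I x)
  lower : ∀ B : Set ℝ, MeasurableSet B →
    -(⨅ x ∈ interior B, I x)
      ≤ liminf (fun T : ℝ≥0 => ((1 / ψ T : ℝ) : EReal) * ENNReal.log (P {ω | X T ω ∈ B})) atTop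

/-- The rate function `J_k` of the linear regime. -/
def rateJ (lam mu α k : ℝ) (x : ℝ) : EReal :=
  if x < 0 then ⊤
  else if x < α / k then ((x * Real.log ((lam + mu) / lam) : ℝ) : EReal)
  else ((x * Real.log (k * x * (lam + mu) / (α * lam)) - x + α / k : ℝ) : EReal)

end UniformCatastrophes

end

/-!
The jump chain climbs by one step at a time and is tight: a catastrophe from height `i` lands
uniformly below `i`, so the drift of `i ↦ s ^ i`, `s > 1`, is negative at large heights whenever
`lam / (lam + mu) * s < 1`. Hence `P(η n ≥ m)` decays, uniformly in `n`, essentially like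
`(lam / (lam + mu)) ^ m`, and `m` consecutive upward jumps after time `n - m` give a matching lower
bound for all `n ≥ m`. As `η n ≤ n`, reaching height `x φ(T)` at time `T` requires in addition that
the Poisson process has made at least `x φ(T)` jumps, which is free for `x < α / k` and otherwise
costs the Poisson rate. The rate function `J_k` is the sum of the two costs.
-/
namespace UniformCatastrophes

open InformationTheory

section CountableValued

variable {Ω S : Type*} [MeasurableSpace Ω] {P : Measure Ω} [MeasurableSpace S]
  [MeasurableSingletonClass S] [Countable S]

lemma lintegral_comp_eq_tsum {X : Ω → S} (hX : AEMeasurable X P) (f : S → ℝ≥0∞) :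
    ∫⁻ ω, f (X ω) ∂P = ∑' i, f i * P {ω | X ω = i} := by
  rw [← lintegral_map' (measurable_of_countable f).aemeasurable hX, lintegral_countable']
  exact tsum_congr fun i => by
    rw [Measure.map_apply_of_aemeasurable hX (measurableSet_singleton i)]; rfl

lemma measure_eq_tsum_measure_fiber {X : Ω → S} (hX : AEMeasurable X P) (A : Set Ω) :
    P A = ∑' i, P {ω | X ω = i ∧ ω ∈ A} := by
  have h := lintegral_comp_eq_tsum (P := P.restrict A) hX.restrict fun _ => 1
  rw [lintegral_one, Measure.restrict_apply_univ] at h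
  rw [h]
  refine tsum_congr fun i => ?_
  rw [one_mul]
  exact Measure.restrict_apply₀ (hX.restrict.nullMeasurableSet_preimage (measurableSet_singleton i))

lemma measure_randomIndex_mem_eq_lintegral {T : Type*} [MeasurableSpace T] {N : Ω → S}
    {X : S → Ω → T} {κ : Measure S} (hN : HasLaw N κ P) (hind : ∀ n, IndepFun N (X n) P)
    {A : Set T} (hA : MeasurableSet A) :
    P {ω | X (N ω) ω ∈ A} = ∫⁻ n, P {ω | X n ω ∈ A} ∂κ := by
  rw [← hN.lintegral_comp (f := fun n => P {ω | X n ω ∈ A})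
      (measurable_of_countable _).aemeasurable,
    lintegral_comp_eq_tsum hN.aemeasurable fun n => P {ω | X n ω ∈ A},
    measure_eq_tsum_measure_fiber hN.aemeasurable]
  refine tsum_congr fun n => ?_
  rw [mul_comm]
  refine Eq.trans (congrArg P ?_)
    ((hind n).measure_inter_preimage_eq_mul {n} A (measurableSet_singleton n) hA)
  ext ω
  exact and_congr_right fun h : N ω = n => by rw [Set.mem_ofPred_eq, h]; rfl

end CountableValued

section TransitionProbabilities

variable {Ω S : Type*} [MeasurableSpace Ω] {P : Measure Ω} [MeasurableSpace S]

/-- The one-step transitions of the process `X` have probabilities `p`. This constrains the joint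
laws of `X n` and `X (n + 1)` only, so it is weaker than the Markov property. -/
structure HasTransitionProb (P : Measure Ω) (p : S → S → ℝ≥0∞) (X : ℕ → Ω → S) : Prop where
  aemeasurable : ∀ n, AEMeasurable (X n) P
  measure_step : ∀ n i j,
    P {ω | X n ω = i ∧ X (n + 1) ω = j} = P {ω | X n ω = i} * p i j

lemma HasTransitionProb.ae_transition_ne_zero [Countable S] {p : S → S → ℝ≥0∞} {X : ℕ → Ω → S}
    (h : HasTransitionProb P p X) (n : ℕ) :
    ∀ᵐ ω ∂P, p (X n ω) (X (n + 1) ω) ≠ 0 := by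
  have hnull (i j : S) (hij : p i j = 0) : ∀ᵐ ω ∂P, ¬(X n ω = i ∧ X (n + 1) ω = j) := by
    rw [ae_iff]
    simpa only [not_not, hij, mul_zero] using h.measure_step n i j
  have hall : ∀ᵐ ω ∂P, ∀ i j, p i j = 0 → ¬(X n ω = i ∧ X (n + 1) ω = j) := by
    simpa only [ae_all_iff] using hnull
  filter_upwards [hall] with ω hω h0
  exact hω _ _ h0 ⟨rfl, rfl⟩

variable [MeasurableSingletonClass S] [Countable S] {p : S → S → ℝ≥0∞} {X : ℕ → Ω → S}

lemma HasTransitionProb.of_history (hX : ∀ n, AEMeasurable (X n) P)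
    (h : ∀ (n : ℕ) (x : ℕ → S) (j : S),
      P {ω | (∀ m ≤ n, X m ω = x m) ∧ X (n + 1) ω = j} =
        P {ω | ∀ m ≤ n, X m ω = x m} * p (x n) j) :
    HasTransitionProb P p X := by
  refine ⟨hX, fun n i j => ?_⟩
  have hH : AEMeasurable (fun ω (m : Fin (n + 1)) => X m ω) P :=
    aemeasurable_pi_lambda _ fun m => hX m
  rw [measure_eq_tsum_measure_fiber hH {ω | X n ω = i ∧ X (n + 1) ω = j},
    measure_eq_tsum_measure_fiber hH {ω | X n ω = i}, ← ENNReal.tsum_mul_right]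
  refine tsum_congr fun x => ?_
  have hfiber (ω : Ω) : (fun m : Fin (n + 1) => X m ω) = x ↔
      ∀ m ≤ n, X m ω = x (Fin.ofNat (n + 1) m) := by
    refine funext_iff.trans ⟨fun H m hm => ?_, fun H m => ?_⟩
    · have hval : (Fin.ofNat (n + 1) m : ℕ) = m := Nat.mod_eq_of_lt (Nat.lt_succ_of_le hm)
      rw [← H, hval]
    · rw [H m (Nat.le_of_lt_succ m.2), Fin.ofNat_eq_cast, Fin.cast_val_eq_self]
  have hlast {ω : Ω} (hω : ∀ m ≤ n, X m ω = x (Fin.ofNat (n + 1) m)) :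
      X n ω = x (Fin.ofNat (n + 1) n) := hω n le_rfl
  simp only [hfiber, Set.mem_ofPred_eq]
  by_cases hi : x (Fin.ofNat (n + 1) n) = i
  · convert h n (fun m => x (Fin.ofNat (n + 1) m)) j using 4 with ω
    · exact ⟨fun H => ⟨H.1, H.2.2⟩, fun H => ⟨H.1, (hlast H.1).trans hi, H.2⟩⟩
    · exact funext fun ω => propext (and_iff_left_of_imp fun H => (hlast H).trans hi)
    · exact hi.symm
  · have hne {ω : Ω} (hω : ∀ m ≤ n, X m ω = x (Fin.ofNat (n + 1) m)) : X n ω ≠ i :=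
      fun H => hi ((hlast hω).symm.trans H)
    have h₁ : {ω | (∀ m ≤ n, X m ω = x (Fin.ofNat (n + 1) m)) ∧ X n ω = i} = ∅ :=
      Set.eq_empty_of_forall_notMem fun ω H => hne H.1 H.2
    have h₂ : {ω | (∀ m ≤ n, X m ω = x (Fin.ofNat (n + 1) m)) ∧
        X n ω = i ∧ X (n + 1) ω = j} = ∅ :=
      Set.eq_empty_of_forall_notMem fun ω H => hne H.1 H.2.1
    rw [h₁, h₂, measure_empty, zero_mul]

namespace HasTransitionProb

lemma lintegral_succ (h : HasTransitionProb P p X) (n : ℕ) (f : S → ℝ≥0∞) :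
    ∫⁻ ω, f (X (n + 1) ω) ∂P = ∫⁻ ω, ∑' j, p (X n ω) j * f j ∂P := by
  have hpair : AEMeasurable (fun ω => (X n ω, X (n + 1) ω)) P :=
    (h.aemeasurable n).prodMk (h.aemeasurable (n + 1))
  calc ∫⁻ ω, f (X (n + 1) ω) ∂P
      = ∑' z : S × S, f z.2 * P {ω | (X n ω, X (n + 1) ω) = z} :=
        lintegral_comp_eq_tsum hpair fun z => f z.2
    _ = ∑' i, ∑' j, f j * (P {ω | X n ω = i} * p i j) := by
        simp only [ENNReal.tsum_prod', Prod.mk.injEq, h.measure_step]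
    _ = ∑' i, (∑' j, p i j * f j) * P {ω | X n ω = i} := by
        refine tsum_congr fun i => ?_
        rw [← ENNReal.tsum_mul_right]
        exact tsum_congr fun j => by ring
    _ = _ := (lintegral_comp_eq_tsum (h.aemeasurable n) fun i => ∑' j, p i j * f j).symm

/-- Foster–Lyapunov drift criterion. -/
lemma lintegral_le_of_drift (h : HasTransitionProb P p X) {V : S → ℝ≥0∞} {ρ K : ℝ≥0∞}
    (hρ : ρ < 1) (hV : ∀ i, ∑' j, p i j * V j ≤ ρ * V i + K) (n : ℕ) :
    ∫⁻ ω, V (X n ω) ∂P ≤ ∫⁻ ω, V (X 0 ω) ∂P + K * P Set.univ / (1 - ρ) := by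
  set L := K * P Set.univ / (1 - ρ)
  have hfix : ρ * L + K * P Set.univ = L := by
    have hKL : L * (1 - ρ) = K * P Set.univ :=
      ENNReal.div_mul_cancel (tsub_pos_of_lt hρ).ne' (by finiteness)
    rw [← hKL, mul_comm ρ, ← mul_add, add_tsub_cancel_of_le hρ.le, mul_one]
  induction n with
  | zero => exact le_self_add
  | succ n ih =>
    calc ∫⁻ ω, V (X (n + 1) ω) ∂P
        = ∫⁻ ω, ∑' j, p (X n ω) j * V j ∂P := h.lintegral_succ n V
      _ ≤ ∫⁻ ω, (ρ * V (X n ω) + K) ∂P := lintegral_mono fun ω => hV (X n ω)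
      _ = ρ * ∫⁻ ω, V (X n ω) ∂P + K * P Set.univ := by
          rw [lintegral_add_right _ measurable_const, lintegral_const_mul' _ _ (by finiteness),
            lintegral_const]
      _ ≤ ρ * (∫⁻ ω, V (X 0 ω) ∂P + L) + K * P Set.univ := by gcongr
      _ ≤ ∫⁻ ω, V (X 0 ω) ∂P + L := by
          rw [mul_add, add_assoc, hfix]
          gcongr
          exact mul_le_of_le_one_left' hρ.le

end HasTransitionProb

end TransitionProbabilities

section JumpChain

variable {Ω : Type*} [MeasurableSpace Ω] {P : Measure Ω}

namespace HasTransitionProb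

section ForcedMoves

variable {S : Type*} [MeasurableSpace S] [MeasurableSingletonClass S] [Countable S]
  {p : S → S → ℝ≥0∞} {X : ℕ → Ω → S} {c : ℝ≥0∞} {g : S → S}

lemma pow_mul_lintegral_iterate_le (h : HasTransitionProb P p X) (hc : ∀ i, c ≤ p i (g i))
    (f : S → ℝ≥0∞) (n m : ℕ) :
    c ^ m * ∫⁻ ω, f (g^[m] (X n ω)) ∂P ≤ ∫⁻ ω, f (X (n + m) ω) ∂P := by
  induction m generalizing f with
  | zero => simp
  | succ m ih =>
    have hf : AEMeasurable (fun ω => f (g (X (n + m) ω))) P :=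
      (measurable_of_countable fun i => f (g i)).comp_aemeasurable (h.aemeasurable (n + m))
    calc c ^ (m + 1) * ∫⁻ ω, f (g^[m + 1] (X n ω)) ∂P
        = c * (c ^ m * ∫⁻ ω, f (g (g^[m] (X n ω))) ∂P) := by
          simp only [pow_succ', mul_assoc, Function.iterate_succ_apply']
      _ ≤ c * ∫⁻ ω, f (g (X (n + m) ω)) ∂P := by gcongr; exact ih fun i => f (g i)
      _ = ∫⁻ ω, c * f (g (X (n + m) ω)) ∂P := (lintegral_const_mul'' c hf).symm
      _ ≤ ∫⁻ ω, ∑' j, p (X (n + m) ω) j * f j ∂P := lintegral_mono fun ω =>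
          le_trans (by gcongr; exact hc _) (ENNReal.le_tsum (g (X (n + m) ω)))
      _ = ∫⁻ ω, f (X (n + (m + 1)) ω) ∂P := (h.lintegral_succ (n + m) f).symm

lemma pow_mul_measure_iterate_mem_le (h : HasTransitionProb P p X) (hc : ∀ i, c ≤ p i (g i))
    (A : Set S) (n m : ℕ) : c ^ m * P {ω | g^[m] (X n ω) ∈ A} ≤ P {ω | X (n + m) ω ∈ A} := by
  have hnull (B : Set S) (n : ℕ) : NullMeasurableSet (X n ⁻¹' B) P :=
    (h.aemeasurable n).nullMeasurableSet_preimage B.to_countable.measurableSet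
  calc c ^ m * P {ω | g^[m] (X n ω) ∈ A}
      = c ^ m * ∫⁻ ω, A.indicator 1 (g^[m] (X n ω)) ∂P :=
        congrArg _ (lintegral_indicator_one₀ (hnull (g^[m] ⁻¹' A) n)).symm
    _ ≤ ∫⁻ ω, A.indicator 1 (X (n + m) ω) ∂P := h.pow_mul_lintegral_iterate_le hc _ n m
    _ = P {ω | X (n + m) ω ∈ A} := lintegral_indicator_one₀ (hnull A (n + m))

end ForcedMoves

variable {p : ℕ → ℕ → ℝ≥0∞} {X : ℕ → Ω → ℕ}

lemma ae_le_index (h : HasTransitionProb P p X) (hX₀ : ∀ᵐ ω ∂P, X 0 ω = 0)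
    (hp : ∀ i j, p i j ≠ 0 → j ≤ i + 1) (n : ℕ) : ∀ᵐ ω ∂P, X n ω ≤ n := by
  induction n with
  | zero => filter_upwards [hX₀] with ω hω using hω.le
  | succ n ih =>
    filter_upwards [ih, h.ae_transition_ne_zero n] with ω hω hstep
    exact (hp _ _ hstep).trans (Nat.succ_le_succ hω)

lemma exists_measure_ge_le_of_drift [IsFiniteMeasure P] (h : HasTransitionProb P p X)
    (hX₀ : ∀ᵐ ω ∂P, X 0 ω = 0) {r : ℝ} (hr : 0 < r) (hr1 : r ≤ 1) {ρ K : ℝ≥0∞} (hρ : ρ < 1)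
    (hK : K ≠ ∞)
    (hdrift : ∀ i, ∑' j, p i j * ENNReal.ofReal (r⁻¹ ^ j) ≤
      ρ * ENNReal.ofReal (r⁻¹ ^ i) + K) :
    ∃ C : ℝ, 0 < C ∧ ∀ n m, P {ω | m ≤ X n ω} ≤ ENNReal.ofReal (C * r ^ m) := by
  set D := P Set.univ + K * P Set.univ / (1 - ρ)
  have hD : D ≠ ∞ := by
    have : 1 - ρ ≠ 0 := (tsub_pos_of_lt hρ).ne'
    finiteness
  have hmean (n : ℕ) : ∫⁻ ω, ENNReal.ofReal (r⁻¹ ^ X n ω) ∂P ≤ D := by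
    refine (h.lintegral_le_of_drift hρ hdrift n).trans_eq ?_
    rw [lintegral_congr_ae (hX₀.mono fun ω hω => by rw [hω])]
    simp [D]
  refine ⟨D.toReal + 1, by positivity, fun n m => ?_⟩
  have hV : AEMeasurable (fun ω => ENNReal.ofReal (r⁻¹ ^ X n ω)) P :=
    (measurable_of_countable fun j : ℕ => ENNReal.ofReal (r⁻¹ ^ j)).comp_aemeasurable
      (h.aemeasurable n)
  calc P {ω | m ≤ X n ω}
      ≤ P {ω | ENNReal.ofReal (r⁻¹ ^ m) ≤ ENNReal.ofReal (r⁻¹ ^ X n ω)} :=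
        measure_mono fun ω hω =>
          ENNReal.ofReal_le_ofReal (pow_le_pow_right₀ ((one_le_inv₀ hr).2 hr1) hω)
    _ ≤ (∫⁻ ω, ENNReal.ofReal (r⁻¹ ^ X n ω) ∂P) / ENNReal.ofReal (r⁻¹ ^ m) :=
        meas_ge_le_lintegral_div hV (by simp [hr]) ENNReal.ofReal_ne_top
    _ ≤ ENNReal.ofReal (D.toReal + 1) / ENNReal.ofReal (r⁻¹ ^ m) := by
        gcongr
        refine (hmean n).trans ?_
        rw [← ENNReal.ofReal_toReal hD]
        exact ENNReal.ofReal_le_ofReal (by simp)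
    _ = ENNReal.ofReal ((D.toReal + 1) * r ^ m) := by
        rw [← ENNReal.ofReal_div_of_pos (by positivity), inv_pow, div_inv_eq_mul]

end HasTransitionProb

variable {lam mu : ℝ}

lemma IsJumpChain.hasTransitionProb {η : ℕ → Ω → ℕ} (h : IsJumpChain P lam mu η) :
    HasTransitionProb P (fun i j => ENNReal.ofReal (transProb lam mu i j)) η :=
  .of_history (fun n => (h.measurable n).aemeasurable) h.markov

lemma transProb_of_add_one_lt {i j : ℕ} (hij : i + 1 < j) : transProb lam mu i j = 0 := by
  unfold transProb
  split_ifs <;> first | rfl | omega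

lemma transProb_nonneg (hlam : 0 < lam) (hmu : 0 < mu) (i j : ℕ) : 0 ≤ transProb lam mu i j := by
  unfold transProb
  split_ifs <;> positivity

lemma lam_div_le_transProb_succ (hlam : 0 < lam) (hmu : 0 < mu) (i : ℕ) :
    lam / (lam + mu) ≤ transProb lam mu i (i + 1) := by
  rcases eq_or_ne i 0 with rfl | hi
  · simpa [transProb] using div_le_one_of_le₀ (by linarith) (by positivity)
  · simp [transProb, hi]

lemma sum_transProb_mul_pow_le (hlam : 0 < lam) (hmu : 0 < mu) {s : ℝ} (hs : 1 < s) {i : ℕ}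
    (hi : i ≠ 0) :
    ∑ j ∈ Finset.range (i + 2), transProb lam mu i j * s ^ j ≤
      (lam / (lam + mu) * s + mu / (i * (lam + mu)) / (s - 1)) * s ^ i := by
  have hbelow : ∑ j ∈ Finset.range i, transProb lam mu i j * s ^ j =
      mu / (i * (lam + mu)) * ((s ^ i - 1) / (s - 1)) := by
    rw [← geom_sum_eq hs.ne', Finset.mul_sum]
    refine Finset.sum_congr rfl fun j hj => ?_
    have hji : j < i := Finset.mem_range.1 hj
    rw [transProb, if_neg hi, if_neg (by omega), if_pos hji]
  rw [Finset.sum_range_succ, Finset.sum_range_succ, hbelow]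
  have hself : transProb lam mu i i = 0 := by simp [transProb, hi]
  have hup : transProb lam mu i (i + 1) = lam / (lam + mu) := by simp [transProb, hi]
  rw [hself, hup]
  have hgeom : mu / (i * (lam + mu)) * ((s ^ i - 1) / (s - 1)) ≤
      mu / (i * (lam + mu)) * (s ^ i / (s - 1)) := by
    have := sub_pos.2 hs
    gcongr
    linarith
  calc _ ≤ mu / (i * (lam + mu)) * (s ^ i / (s - 1)) + 0 * s ^ i +
        lam / (lam + mu) * s ^ (i + 1) := by gcongr
    _ = _ := by ring

/-- Since `lam / (lam + mu) * s < 1`, the jump of size `1` contracts `s ^ i` in the mean; the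
catastrophes contribute a term of relative size `O(1 / i)`. -/
lemma exists_drift_transProb (hlam : 0 < lam) (hmu : 0 < mu) {s : ℝ} (hs : 1 < s)
    (hps : lam / (lam + mu) * s < 1) :
    ∃ ρ < (1 : ℝ≥0∞), ∃ K ≠ ∞, ∀ i : ℕ,
      ∑' j, ENNReal.ofReal (transProb lam mu i j) * ENNReal.ofReal (s ^ j) ≤
        ρ * ENNReal.ofReal (s ^ i) + K := by
  have hsum (i : ℕ) : ∑' j, ENNReal.ofReal (transProb lam mu i j) * ENNReal.ofReal (s ^ j) =
      ENNReal.ofReal (∑ j ∈ Finset.range (i + 2), transProb lam mu i j * s ^ j) := by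
    have hnn (j : ℕ) := transProb_nonneg hlam hmu i j
    rw [ENNReal.ofReal_sum_of_nonneg fun j _ => mul_nonneg (hnn j) (by positivity),
      tsum_eq_sum fun j hj => ?_]
    · exact Finset.sum_congr rfl fun j _ => (ENNReal.ofReal_mul (hnn j)).symm
    · rw [transProb_of_add_one_lt (not_lt.1 (mt Finset.mem_range.2 hj)), ENNReal.ofReal_zero,
        zero_mul]
  obtain ⟨ρ, hρ, hρ1⟩ := exists_between hps
  have hlim : Tendsto (fun i : ℕ => lam / (lam + mu) * s + mu / (i * (lam + mu)) / (s - 1)) atTop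
      (𝓝 (lam / (lam + mu) * s)) := by
    have hden : Tendsto (fun i : ℕ => (i : ℝ) * (lam + mu)) atTop atTop :=
      tendsto_natCast_atTop_atTop.atTop_mul_const (by positivity)
    simpa using tendsto_const_nhds.add ((hden.const_div_atTop mu).div_const (s - 1))
  obtain ⟨N, hN⟩ := eventually_atTop.1 (hlim.eventually_le_const hρ)
  refine ⟨ENNReal.ofReal ρ, by simpa using hρ1,
    ∑ i ∈ Finset.range (N + 1), ENNReal.ofReal
      (∑ j ∈ Finset.range (i + 2), transProb lam mu i j * s ^ j),
    ENNReal.sum_ne_top.2 fun _ _ => ENNReal.ofReal_ne_top, fun i => ?_⟩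
  rw [hsum]
  rcases lt_or_ge i (N + 1) with hi | hi
  · exact le_add_left (Finset.single_le_sum_of_canonicallyOrdered
      (f := fun i => ENNReal.ofReal (∑ j ∈ Finset.range (i + 2), transProb lam mu i j * s ^ j))
      (Finset.mem_range.2 hi))
  · refine le_add_right ?_
    rw [← ENNReal.ofReal_mul' (by positivity)]
    refine ENNReal.ofReal_le_ofReal
      ((sum_transProb_mul_pow_le hlam hmu hs (by omega)).trans ?_)
    gcongr
    exact hN i (by omega)

variable {η : ℕ → Ω → ℕ}

lemma exists_measure_jumpChain_ge_le [IsFiniteMeasure P]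
    (hη : HasTransitionProb P (fun i j => ENNReal.ofReal (transProb lam mu i j)) η)
    (hη₀ : ∀ᵐ ω ∂P, η 0 ω = 0) (hlam : 0 < lam) (hmu : 0 < mu) {r : ℝ}
    (hr : lam / (lam + mu) < r) (hr1 : r < 1) :
    ∃ C : ℝ, 0 < C ∧ ∀ n m, P {ω | m ≤ η n ω} ≤ ENNReal.ofReal (C * r ^ m) := by
  have hr0 : 0 < r := lt_trans (by positivity) hr
  obtain ⟨ρ, hρ, K, hK, hdrift⟩ := exists_drift_transProb hlam hmu ((one_lt_inv₀ hr0).2 hr1)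
    (by rwa [← div_eq_mul_inv, div_lt_one hr0])
  exact hη.exists_measure_ge_le_of_drift hη₀ hr0 hr1.le hρ hK hdrift

lemma exists_inv_two_le_measure_le [IsProbabilityMeasure P] {ι : Type*} {X : ι → Ω → ℕ}
    (hX : ∀ n, AEMeasurable (X n) P) {C r : ℝ} (hC : 0 < C) (hr1 : r < 1)
    (htail : ∀ n m, P {ω | m ≤ X n ω} ≤ ENNReal.ofReal (C * r ^ m)) :
    ∃ M : ℕ, ∀ n, 2⁻¹ ≤ P {ω | X n ω ≤ M} := by
  obtain ⟨M, hM⟩ := exists_pow_lt_of_lt_one (show 0 < 2⁻¹ / C by positivity) hr1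
  refine ⟨M, fun n => ?_⟩
  have hsmall : C * r ^ M ≤ 2⁻¹ := (mul_comm _ _).trans_le ((lt_div_iff₀ hC).1 hM).le
  have hcompl : P (X n ⁻¹' Set.Iic M)ᶜ ≤ 2⁻¹ :=
    calc P (X n ⁻¹' Set.Iic M)ᶜ ≤ P {ω | M ≤ X n ω} :=
          measure_mono fun ω (hω : ¬X n ω ≤ M) => (not_le.1 hω).le
      _ ≤ ENNReal.ofReal 2⁻¹ := (htail n M).trans (ENNReal.ofReal_le_ofReal hsmall)
      _ = 2⁻¹ := by simp
  rw [prob_compl_eq_one_sub₀ ((hX n).nullMeasurableSet_preimage measurableSet_Iic),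
    tsub_le_iff_left] at hcompl
  rwa [← ENNReal.inv_two_add_inv_two, ENNReal.add_le_add_iff_right (by simp)] at hcompl

/-- Tightness lets the chain reach height about `m` by `m` consecutive upward jumps from a bounded
height, whatever the time `n ≥ m`. -/
lemma exists_le_measure_jumpChain_mem_Icc [IsProbabilityMeasure P]
    (hη : HasTransitionProb P (fun i j => ENNReal.ofReal (transProb lam mu i j)) η)
    (hη₀ : ∀ᵐ ω ∂P, η 0 ω = 0) (hlam : 0 < lam) (hmu : 0 < mu) :
    ∃ M : ℕ, ∀ n m, m ≤ n →
      ENNReal.ofReal ((lam / (lam + mu)) ^ m / 2) ≤ P {ω | η n ω ∈ Set.Icc m (m + M)} := by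
  obtain ⟨r, hr, hr1⟩ := exists_between
    (show lam / (lam + mu) < 1 from (div_lt_one (by positivity)).2 (by linarith))
  obtain ⟨C, hC, htail⟩ := exists_measure_jumpChain_ge_le hη hη₀ hlam hmu hr hr1
  obtain ⟨M, htight⟩ := exists_inv_two_le_measure_le hη.aemeasurable hC hr1 htail
  refine ⟨M, fun n m hmn => ?_⟩
  obtain ⟨l, rfl⟩ := Nat.exists_eq_add_of_le' hmn
  calc ENNReal.ofReal ((lam / (lam + mu)) ^ m / 2)
      = ENNReal.ofReal (lam / (lam + mu)) ^ m * 2⁻¹ := by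
        rw [ENNReal.ofReal_div_of_pos two_pos, ENNReal.ofReal_pow (by positivity),
          ENNReal.ofReal_ofNat, div_eq_mul_inv]
    _ ≤ ENNReal.ofReal (lam / (lam + mu)) ^ m *
          P {ω | Nat.succ^[m] (η l ω) ∈ Set.Icc m (m + M)} := by
        gcongr
        refine (htight l).trans (measure_mono fun ω (hω : η l ω ≤ M) => ?_)
        simp only [Set.mem_ofPred_eq, Nat.succ_iterate, Set.mem_Icc]
        omega
    _ ≤ P {ω | η (l + m) ω ∈ Set.Icc m (m + M)} :=
        hη.pow_mul_measure_iterate_mem_le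
          (fun i => ENNReal.ofReal_le_ofReal (lam_div_le_transProb_succ hlam hmu i)) _ l m

end JumpChain

section Ratios

variable {ι : Type*} {l : Filter ι} {ψ a v : ι → ℝ} {b y : ℝ}

lemma tendsto_atTop_of_tendsto_div_pos (hψ : Tendsto ψ l atTop) (hb : 0 < b)
    (ha : Tendsto (fun i => a i / ψ i) l (𝓝 b)) : Tendsto a l atTop := by
  refine (ha.pos_mul_atTop hb hψ).congr' ?_
  filter_upwards [hψ.eventually_ne_atTop 0] with i hi using div_mul_cancel₀ _ hi

lemma tendsto_div_of_tendsto_div_div (hψ : Tendsto ψ l atTop) (hb : b ≠ 0)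
    (ha : Tendsto (fun i => a i / ψ i) l (𝓝 b)) (hv : Tendsto (fun i => v i / ψ i) l (𝓝 y)) :
    Tendsto (fun i => v i / a i) l (𝓝 (y / b)) := by
  refine (hv.div ha hb).congr' ?_
  filter_upwards [hψ.eventually_ne_atTop 0] with i hi using div_div_div_cancel_right₀ hi _ _

end Ratios

section Poisson

lemma lintegral_ofReal_pow_poissonMeasure (a : ℝ≥0) {z : ℝ} (hz : 0 ≤ z) :
    ∫⁻ n, ENNReal.ofReal (z ^ n) ∂poissonMeasure a = ENNReal.ofReal (Real.exp (a * (z - 1))) := by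
  have hsum : HasSum (fun n : ℕ => z ^ n * (Real.exp (-a) * a ^ n / n.factorial))
      (Real.exp (a * (z - 1))) := by
    convert! (NormedSpace.expSeries_div_hasSum_exp (a * z : ℝ)).mul_left (Real.exp (-a)) using 1
    · exact funext fun n => by ring
    · rw [← Real.exp_eq_exp_ℝ, ← Real.exp_add]; ring_nf
  rw [lintegral_countable', ← hsum.tsum_eq,
    ENNReal.ofReal_tsum_of_nonneg (fun n => by positivity) hsum.summable]
  exact tsum_congr fun n => by
    rw [poissonMeasure_singleton, ← ENNReal.ofReal_mul (by positivity)]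

/-- Chernoff's bound, with the optimal exponent `log z`, `z = max (m / a) 1`. For `a = 0` the
junk value `m / 0 = 0` gives the trivial bound `1`. -/
lemma poissonMeasure_Ici_le (a : ℝ≥0) (m : ℕ) :
    poissonMeasure a (Set.Ici m) ≤ ENNReal.ofReal (Real.exp (-(a * klFun (max (m / a) 1)))) := by
  set z : ℝ := max (m / a) 1 with hz
  have hz1 : 1 ≤ z := le_max_right _ _
  have hz0 : 0 < z := zero_lt_one.trans_le hz1
  have hmz : m * Real.log z = a * (z * Real.log z) := by
    rcases max_choice ((m : ℝ) / a) 1 with h | h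
    · have ha : (a : ℝ) ≠ 0 := by
        rintro ha
        rw [hz, h, ha, div_zero] at hz0
        exact hz0.false
      rw [← mul_assoc, hz, h, mul_div_cancel₀ _ ha]
    · rw [hz, h]; simp
  calc poissonMeasure a (Set.Ici m)
      ≤ poissonMeasure a {n | ENNReal.ofReal (z ^ m) ≤ ENNReal.ofReal (z ^ n)} :=
        measure_mono fun n hn => ENNReal.ofReal_le_ofReal (pow_le_pow_right₀ hz1 hn)
    _ ≤ (∫⁻ n, ENNReal.ofReal (z ^ n) ∂poissonMeasure a) / ENNReal.ofReal (z ^ m) :=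
        meas_ge_le_lintegral_div (measurable_of_countable _).aemeasurable
          (ENNReal.ofReal_pos.2 (by positivity)).ne' ENNReal.ofReal_ne_top
    _ = ENNReal.ofReal (Real.exp (a * (z - 1)) / z ^ m) := by
        rw [lintegral_ofReal_pow_poissonMeasure a hz0.le, ENNReal.ofReal_div_of_pos (by positivity)]
    _ = ENNReal.ofReal (Real.exp (-(a * klFun z))) := by
        rw [← Real.exp_log (pow_pos hz0 m), ← Real.exp_sub, Real.log_pow, hmz, klFun_apply]
        ring_nf

lemma tendsto_log_factorial_sub_div :
    Tendsto (fun n : ℕ => (Real.log n.factorial - (n * Real.log n - n)) / n) atTop (𝓝 0) := by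
  have hn : Tendsto (fun n : ℕ => (n : ℝ)) atTop atTop := tendsto_natCast_atTop_atTop
  have hstirling : Tendsto (fun n : ℕ => Real.log (Stirling.stirlingSeq n) / n) atTop (𝓝 0) :=
    (Stirling.tendsto_stirlingSeq_sqrt_pi.log (by positivity)).div_atTop hn
  have hlog : Tendsto (fun n : ℕ => Real.log (2 * n) / (2 * n)) atTop (𝓝 0) :=
    Real.isLittleO_log_id_atTop.tendsto_div_nhds_zero.comp (hn.const_mul_atTop two_pos)
  have hsum := hstirling.add hlog
  rw [add_zero] at hsum
  refine hsum.congr' ?_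
  filter_upwards [eventually_ne_atTop 0] with n hn0
  have : (n : ℝ) ≠ 0 := Nat.cast_ne_zero.2 hn0
  rw [Stirling.log_stirlingSeq_formula, Real.log_div this (Real.exp_ne_zero 1), Real.log_exp]
  field_simp
  ring

lemma log_poissonMeasure_real_singleton {a : ℝ≥0} (ha : 0 < a) (n : ℕ) :
    Real.log ((poissonMeasure a).real {n}) =
      -(a * klFun (n / a)) - (Real.log n.factorial - (n * Real.log n - n)) := by
  have ha' : (a : ℝ) ≠ 0 := by positivity
  have hdiv : n * Real.log (n / a) = n * (Real.log n - Real.log a) := by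
    rcases eq_or_ne n 0 with rfl | hn
    · simp
    · rw [Real.log_div (Nat.cast_ne_zero.2 hn) ha']
  rw [poissonMeasure_real_singleton, Real.log_div (by positivity) (by positivity),
    Real.log_mul (by positivity) (by positivity), Real.log_exp, Real.log_pow, klFun_apply]
  field_simp
  linear_combination hdiv

lemma tendsto_log_poissonMeasure_real_singleton_div {ι : Type*} {l : Filter ι} {ψ : ι → ℝ}
    {a : ι → ℝ≥0} {n : ι → ℕ} {b y : ℝ} (hψ : Tendsto ψ l atTop) (hb : 0 < b) (hy : 0 < y)
    (ha : Tendsto (fun i => (a i : ℝ) / ψ i) l (𝓝 b))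
    (hn : Tendsto (fun i => (n i : ℝ) / ψ i) l (𝓝 y)) :
    Tendsto (fun i => Real.log ((poissonMeasure (a i)).real {n i}) / ψ i) l
      (𝓝 (-(b * klFun (y / b)))) := by
  have ha_atTop := tendsto_atTop_of_tendsto_div_pos hψ hb ha
  have hn_atTop := tendsto_natCast_atTop_iff.1 (tendsto_atTop_of_tendsto_div_pos hψ hy hn)
  have hmain := ha.mul ((continuous_klFun.tendsto _).comp
    (tendsto_div_of_tendsto_div_div hψ hb.ne' ha hn))
  have hstirling := (tendsto_log_factorial_sub_div.comp hn_atTop).mul hn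
  have hlim := hmain.neg.sub hstirling
  rw [zero_mul, sub_zero] at hlim
  refine hlim.congr' ?_
  filter_upwards [ha_atTop.eventually_gt_atTop 0, hn_atTop.eventually_ne_atTop 0] with i hai hni
  have hni' : (n i : ℝ) ≠ 0 := Nat.cast_ne_zero.2 hni
  rw [log_poissonMeasure_real_singleton (NNReal.coe_pos.1 hai)]
  simp only [Function.comp_apply]
  field_simp

lemma IsPoissonProcess.hasLaw {Ω : Type*} [MeasurableSpace Ω] {P : Measure Ω} {α : ℝ≥0}
    {ν : ℝ≥0 → Ω → ℕ} (h : IsPoissonProcess P α ν) (T : ℝ≥0) :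
    HasLaw (ν T) (poissonMeasure (α * T)) P := by
  have hlaw := h.law 0 T zero_le
  rw [tsub_zero] at hlaw
  refine hlaw.congr ?_
  filter_upwards [h.initial] with ω hω
  rw [hω, tsub_zero]

end Poisson

section RandomIndex

variable {Ω : Type*} [MeasurableSpace Ω] {P : Measure Ω} {N : Ω → ℕ} {X : ℕ → Ω → ℕ}
  {κ : Measure ℕ}

lemma measure_le_randomIndex_le (hN : HasLaw N κ P) (hind : ∀ n, IndepFun N (X n) P)
    (hX : ∀ n, ∀ᵐ ω ∂P, X n ω ≤ n) {m : ℕ} {c : ℝ≥0∞} (hc : ∀ n, P {ω | m ≤ X n ω} ≤ c) :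
    P {ω | m ≤ X (N ω) ω} ≤ c * κ (Set.Ici m) := by
  refine (measure_randomIndex_mem_eq_lintegral hN hind measurableSet_Ici).trans_le ?_
  rw [← lintegral_indicator_const measurableSet_Ici]
  refine lintegral_mono fun n => ?_
  rcases le_or_gt m n with hmn | hnm
  · exact (hc n).trans_eq (Set.indicator_of_mem (Set.mem_Ici.2 hmn) fun _ => c).symm
  · refine le_of_eq_of_le (measure_eq_zero_iff_ae_notMem.2 ?_) zero_le
    filter_upwards [hX n] with ω hω
    exact not_le.2 (hω.trans_lt hnm)

lemma mul_le_measure_randomIndex_mem (hN : HasLaw N κ P) (hind : ∀ n, IndepFun N (X n) P)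
    (A : Set ℕ) (n : ℕ) : κ {n} * P {ω | X n ω ∈ A} ≤ P {ω | X (N ω) ω ∈ A} := by
  rw [measure_randomIndex_mem_eq_lintegral hN hind A.to_countable.measurableSet,
    lintegral_countable', mul_comm]
  exact ENNReal.le_tsum (f := fun n => P {ω | X n ω ∈ A} * κ {n}) n

end RandomIndex

section RateFunction

/-- The real-valued function agreeing with `rateJ lam mu α k` on `[0, ∞)`, for `b = α / k` and
`p = lam / (lam + mu)`. The first term is the cost, relative to a Poisson variable of mean
proportional to `b`, of at least `x` jumps; the second is the cost of `x` upward jumps. -/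
noncomputable def finiteRate (p b x : ℝ) : ℝ :=
  b * klFun (max (x / b) 1) - x * Real.log p

lemma continuous_finiteRate (p b : ℝ) : Continuous (finiteRate p b) := by
  have := continuous_klFun
  unfold finiteRate
  fun_prop

lemma mul_neg_log_le_finiteRate {b : ℝ} (hb : 0 ≤ b) (p x : ℝ) :
    x * -Real.log p ≤ finiteRate p b x := by
  have hkl : 0 ≤ klFun (max (x / b) 1) := klFun_nonneg (zero_le_one.trans (le_max_right _ _))
  rw [finiteRate, mul_neg, sub_eq_neg_add]
  exact le_add_of_nonneg_right (mul_nonneg hb hkl)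

variable {lam mu α k : ℝ}

lemma rateJ_of_neg {x : ℝ} (hx : x < 0) : rateJ lam mu α k x = ⊤ := if_pos hx

lemma rateJ_of_nonneg (hlam : 0 < lam) (hmu : 0 < mu) (hα : 0 < α) (hk : 0 < k) {x : ℝ}
    (hx : 0 ≤ x) : rateJ lam mu α k x = finiteRate (lam / (lam + mu)) (α / k) x := by
  have hb : 0 < α / k := by positivity
  rw [rateJ, if_neg hx.not_gt, finiteRate]
  split_ifs with hxb
  · rw [max_eq_right ((div_le_one hb).2 hxb.le), klFun_one, ← inv_div lam, Real.log_inv]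
    congr 1
    ring
  · have hx0 : 0 < x := hb.trans_le (not_lt.1 hxb)
    have hsplit : k * x * (lam + mu) / (α * lam) = x / (α / k) / (lam / (lam + mu)) := by
      field_simp
    rw [max_eq_left ((one_le_div hb).2 (not_lt.1 hxb)), klFun_apply, hsplit,
      Real.log_div (by positivity) (by positivity)]
    congr 1
    field_simp
    ring

lemma neg_log_div_add_pos (hlam : 0 < lam) (hmu : 0 < mu) : 0 < -Real.log (lam / (lam + mu)) :=
  neg_pos.2 (Real.log_neg (by positivity) ((div_lt_one (by positivity)).2 (by linarith)))

lemma rateJ_nonneg (hlam : 0 < lam) (hmu : 0 < mu) (hα : 0 < α) (hk : 0 < k) (x : ℝ) :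
    0 ≤ rateJ lam mu α k x := by
  rcases lt_or_ge x 0 with hx | hx
  · exact (rateJ_of_neg hx).symm ▸ le_top
  · rw [rateJ_of_nonneg hlam hmu hα hk hx]
    exact EReal.coe_nonneg.2 ((mul_nonneg hx (neg_log_div_add_pos hlam hmu).le).trans
      (mul_neg_log_le_finiteRate (by positivity) _ x))

lemma isCompact_rateJ_le (hlam : 0 < lam) (hmu : 0 < mu) (hα : 0 < α) (hk : 0 < k) (c : ℝ) :
    IsCompact {x : ℝ | rateJ lam mu α k x ≤ (c : EReal)} := by
  set p := lam / (lam + mu)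
  have hlevel : {x : ℝ | rateJ lam mu α k x ≤ (c : EReal)} =
      Set.Ici 0 ∩ {x | finiteRate p (α / k) x ≤ c} := by
    ext x
    rcases lt_or_ge x 0 with hx | hx
    · simp [rateJ_of_neg hx, hx]
    · simp [rateJ_of_nonneg hlam hmu hα hk hx, hx, p]
  rw [hlevel]
  refine isCompact_Icc (a := (0 : ℝ)) (b := c / -Real.log p) |>.of_isClosed_subset
    (isClosed_Ici.inter (isClosed_le (continuous_finiteRate p _) continuous_const)) ?_
  rintro x ⟨hx0, hxc⟩
  exact ⟨hx0, (le_div_iff₀ (neg_log_div_add_pos hlam hmu)).2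
    ((mul_neg_log_le_finiteRate (by positivity) p x).trans hxc)⟩

end RateFunction

section LogarithmicLimits

variable {Ω ι : Type*} [MeasurableSpace Ω] {P : Measure Ω} {l : Filter ι} {s : ι → ℝ}
  {A : ι → Set Ω}

/-- The normalized logarithm `(log P(A)) / s` of a probability, with values in `[-∞, ∞]`. -/
noncomputable def logMeasureDiv (P : Measure Ω) (s : ℝ) (A : Set Ω) : EReal :=
  ((1 / s : ℝ) : EReal) * ENNReal.log (P A)

lemma logMeasureDiv_mono {t : ℝ} (ht : 0 ≤ t) {A B : Set Ω} (hAB : A ⊆ B) :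
    logMeasureDiv P t A ≤ logMeasureDiv P t B :=
  mul_le_mul_of_nonneg_left (ENNReal.log_monotone (measure_mono hAB))
    (EReal.coe_nonneg.2 (by positivity))

lemma logMeasureDiv_empty {t : ℝ} (ht : 0 < t) : logMeasureDiv P t ∅ = ⊥ := by
  rw [logMeasureDiv, measure_empty, ENNReal.log_zero, EReal.coe_mul_bot_of_pos (by positivity)]

lemma coe_mul_log_ofReal {t u : ℝ} (hu : 0 < u) :
    ((1 / t : ℝ) : EReal) * ENNReal.log (ENNReal.ofReal u) = ((Real.log u / t : ℝ) : EReal) := by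
  rw [ENNReal.log_ofReal_of_pos hu, ← EReal.coe_mul, one_div_mul_eq_div]

variable {Y : ι → Ω → ℝ} {I : ℝ → EReal}

/-- One tail suffices: `{Y i ∈ B} ⊆ {x₀ ≤ Y i}` for the least point `x₀` of
`closure B ∩ [0, ∞)`. -/
lemma limsup_logMeasureDiv_mem_le (hs : ∀ᶠ i in l, 0 < s i) (hY : ∀ᶠ i in l, ∀ ω, 0 ≤ Y i ω)
    (htail : ∀ x, 0 ≤ x → limsup (fun i => logMeasureDiv P (s i) {ω | x ≤ Y i ω}) l ≤ -I x)
    (B : Set ℝ) :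
    limsup (fun i => logMeasureDiv P (s i) {ω | Y i ω ∈ B}) l ≤ -⨅ x ∈ closure B, I x := by
  have hmem {i : ι} {ω : Ω} (hi : ∀ ω, 0 ≤ Y i ω) (hω : Y i ω ∈ B) :
      Y i ω ∈ closure B ∩ Set.Ici 0 := ⟨subset_closure hω, hi ω⟩
  have hbdd : BddBelow (closure B ∩ Set.Ici 0) := ⟨0, fun _ hx => hx.2⟩
  rcases (closure B ∩ Set.Ici 0).eq_empty_or_nonempty with hempty | hne
  · refine le_trans (limsup_le_of_le (h := ?_)) bot_le
    filter_upwards [hs, hY] with i hsi hYi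
    have : {ω | Y i ω ∈ B} = ∅ :=
      Set.eq_empty_of_forall_notMem fun ω hω => hempty.le (hmem hYi hω)
    rw [this, logMeasureDiv_empty hsi]
  · obtain ⟨hx₀B, hx₀⟩ := (isClosed_closure.inter isClosed_Ici).csInf_mem hne hbdd
    calc limsup (fun i => logMeasureDiv P (s i) {ω | Y i ω ∈ B}) l
        ≤ limsup (fun i => logMeasureDiv P (s i)
          {ω | sInf (closure B ∩ Set.Ici 0) ≤ Y i ω}) l := by
          refine limsup_le_limsup ?_
          filter_upwards [hs, hY] with i hsi hYi
          exact logMeasureDiv_mono hsi.le fun ω hω => csInf_le hbdd (hmem hYi hω)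
      _ ≤ -I (sInf (closure B ∩ Set.Ici 0)) := htail _ hx₀
      _ ≤ -⨅ x ∈ closure B, I x := EReal.neg_le_neg_iff.2 (iInf₂_le _ hx₀B)

lemma le_liminf_logMeasureDiv_mem (hI : ∀ x < 0, I x = ⊤)
    (hnhds : ∀ x, 0 ≤ x → ∀ U ∈ 𝓝 x,
      -I x ≤ liminf (fun i => logMeasureDiv P (s i) {ω | Y i ω ∈ U}) l) (B : Set ℝ) :
    -⨅ x ∈ interior B, I x ≤ liminf (fun i => logMeasureDiv P (s i) {ω | Y i ω ∈ B}) l := by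
  rw [EReal.neg_le]
  refine le_iInf₂ fun x hx => ?_
  rcases lt_or_ge x 0 with hx0 | hx0
  · exact (hI x hx0).symm ▸ le_top
  · exact EReal.neg_le.1 (hnhds x hx0 B (mem_interior_iff_mem_nhds.1 hx))

variable [l.NeBot] {u : ι → ℝ} {c : ℝ}

lemma limsup_logMeasureDiv_le (hs : ∀ᶠ i in l, 0 < s i) (hu : ∀ᶠ i in l, 0 < u i)
    (hA : ∀ᶠ i in l, P (A i) ≤ ENNReal.ofReal (u i))
    (hlim : Tendsto (fun i => Real.log (u i) / s i) l (𝓝 c)) :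
    limsup (fun i => logMeasureDiv P (s i) (A i)) l ≤ c := by
  rw [← (EReal.tendsto_coe.2 hlim).limsup_eq]
  refine limsup_le_limsup ?_
  filter_upwards [hs, hu, hA] with i hsi hui hAi
  rw [← coe_mul_log_ofReal hui]
  exact mul_le_mul_of_nonneg_left (ENNReal.log_monotone hAi)
    (EReal.coe_nonneg.2 (by positivity))

lemma le_liminf_logMeasureDiv (hs : ∀ᶠ i in l, 0 < s i) (hu : ∀ᶠ i in l, 0 < u i)
    (hA : ∀ᶠ i in l, ENNReal.ofReal (u i) ≤ P (A i))
    (hlim : Tendsto (fun i => Real.log (u i) / s i) l (𝓝 c)) :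
    c ≤ liminf (fun i => logMeasureDiv P (s i) (A i)) l := by
  rw [← (EReal.tendsto_coe.2 hlim).liminf_eq]
  refine liminf_le_liminf ?_
  filter_upwards [hs, hu, hA] with i hsi hui hAi
  rw [← coe_mul_log_ofReal hui]
  exact mul_le_mul_of_nonneg_left (ENNReal.log_monotone hAi)
    (EReal.coe_nonneg.2 (by positivity))

end LogarithmicLimits

section CompoundAsymptotics

variable {Ω ι : Type*} [MeasurableSpace Ω] {P : Measure Ω} {l : Filter ι} [l.NeBot]
  {X : ι → Ω → ℕ} {a : ι → ℝ≥0} {ψ : ι → ℝ} {b : ℝ}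

lemma limsup_logMeasureDiv_le_div_le (hψ : Tendsto ψ l atTop)
    (ha : Tendsto (fun i => (a i : ℝ) / ψ i) l (𝓝 b)) (hb : 0 < b) {C r : ℝ} (hC : 0 < C)
    (hr : 0 < r)
    (hX : ∀ i m, P {ω | m ≤ X i ω} ≤
      ENNReal.ofReal (C * r ^ m * Real.exp (-(a i * klFun (max (m / a i) 1)))))
    {x : ℝ} (hx : 0 ≤ x) :
    limsup (fun i => logMeasureDiv P (ψ i) {ω | x ≤ X i ω / ψ i}) l ≤
      ((-finiteRate r b x : ℝ) : EReal) := by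
  set m : ι → ℕ := fun i => ⌈x * ψ i⌉₊
  have hψ0 := hψ.eventually_gt_atTop 0
  have hm : Tendsto (fun i => (m i : ℝ) / ψ i) l (𝓝 x) :=
    (tendsto_nat_ceil_mul_div_atTop hx).comp hψ
  have hma : Tendsto (fun i => (m i : ℝ) / a i) l (𝓝 (x / b)) :=
    tendsto_div_of_tendsto_div_div hψ hb.ne' ha hm
  have hkl : Tendsto (fun i => klFun (max (m i / a i) 1)) l (𝓝 (klFun (max (x / b) 1))) :=
    (continuous_klFun.tendsto _).comp (hma.max tendsto_const_nhds)
  refine limsup_logMeasureDiv_le hψ0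
    (u := fun i => C * r ^ m i * Real.exp (-(a i * klFun (max (m i / a i) 1))))
    (.of_forall fun i => by positivity) ?_ ?_
  · filter_upwards [hψ0] with i hi
    refine (measure_mono fun ω hω => ?_).trans (hX i (m i))
    exact Nat.ceil_le.2 ((le_div_iff₀ hi).1 hω)
  · have hlim := ((hψ.const_div_atTop (Real.log C)).add (hm.mul_const (Real.log r))).sub
      (ha.mul hkl)
    convert hlim using 2 with i
    · rw [Real.log_mul (by positivity) (by positivity), Real.log_mul hC.ne' (by positivity),
        Real.log_exp, Real.log_pow]
      ring
    · rw [finiteRate]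
      ring

lemma neg_finiteRate_le_liminf_logMeasureDiv (hψ : Tendsto ψ l atTop)
    (ha : Tendsto (fun i => (a i : ℝ) / ψ i) l (𝓝 b)) (hb : 0 < b) {c p : ℝ} (hc : 0 < c)
    (hp : 0 < p) {M : ℕ}
    (hX : ∀ i m n, m ≤ n → ENNReal.ofReal (c * p ^ m * (poissonMeasure (a i)).real {n}) ≤
      P {ω | X i ω ∈ Set.Icc m (m + M)})
    {x : ℝ} (hx : 0 ≤ x) {U : Set ℝ} (hU : U ∈ 𝓝 x) :
    ((-finiteRate p b x : ℝ) : EReal) ≤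
      liminf (fun i => logMeasureDiv P (ψ i) {ω | X i ω / ψ i ∈ U}) l := by
  set m : ι → ℕ := fun i => ⌈x * ψ i⌉₊
  set n : ι → ℕ := fun i => max (m i) ⌈b * ψ i⌉₊
  have hψ0 := hψ.eventually_gt_atTop 0
  have hm : Tendsto (fun i => (m i : ℝ) / ψ i) l (𝓝 x) :=
    (tendsto_nat_ceil_mul_div_atTop hx).comp hψ
  have hmM : Tendsto (fun i => ((m i + M : ℕ) : ℝ) / ψ i) l (𝓝 x) := by
    simpa [add_div] using hm.add (hψ.const_div_atTop (M : ℝ))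
  have hn : Tendsto (fun i => (n i : ℝ) / ψ i) l (𝓝 (max x b)) := by
    refine (hm.max ((tendsto_nat_ceil_mul_div_atTop hb.le).comp hψ)).congr' ?_
    filter_upwards [hψ0] with i hi
    simp only [n, Nat.cast_max, Function.comp_apply, max_div_div_right hi.le]
  have hpoisson := tendsto_log_poissonMeasure_real_singleton_div hψ hb (by positivity) ha hn
  have hpos : ∀ᶠ i in l, 0 < (poissonMeasure (a i)).real {n i} := by
    filter_upwards [(tendsto_atTop_of_tendsto_div_pos hψ hb ha).eventually_gt_atTop 0] with i hi
    exact poissonMeasure_real_singleton_pos (n i) (NNReal.coe_pos.1 hi)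
  refine le_liminf_logMeasureDiv hψ0
    (u := fun i => c * p ^ m i * (poissonMeasure (a i)).real {n i}) ?_ ?_ ?_
  · filter_upwards [hpos] with i hi
    positivity
  · filter_upwards [hψ0, tendsto_smallSets_iff.1 (hm.Icc hmM) U hU] with i hi hUi
    refine (hX i (m i) (n i) (le_max_left _ _)).trans (measure_mono fun ω hω => hUi ?_)
    exact ⟨by gcongr; exact hω.1, by gcongr; exact hω.2⟩
  · have hlim := ((hψ.const_div_atTop (Real.log c)).add (hm.mul_const (Real.log p))).add hpoisson
    have hval : 0 + x * Real.log p + -(b * klFun (max x b / b)) = -finiteRate p b x := by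
      rw [finiteRate, ← max_div_div_right hb.le, div_self hb.ne']
      ring
    refine (hval ▸ hlim).congr' ?_
    filter_upwards [hpos] with i hi
    rw [Real.log_mul (by positivity) hi.ne', Real.log_mul hc.ne' (by positivity), Real.log_pow]
    ring

end CompoundAsymptotics

section LargeDeviations

variable {Ω : Type*} [MeasurableSpace Ω] {P : Measure Ω} {lam mu : ℝ} {α : ℝ≥0}
  {η : ℕ → Ω → ℕ} {ν : ℝ≥0 → Ω → ℕ}

lemma exists_measure_process_ge_le
    (hη : HasTransitionProb P (fun i j => ENNReal.ofReal (transProb lam mu i j)) η)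
    (hη₀ : ∀ᵐ ω ∂P, η 0 ω = 0) (hν : ∀ T, HasLaw (ν T) (poissonMeasure (α * T)) P)
    (hind : ∀ T n, IndepFun (ν T) (η n) P) (hlam : 0 < lam) (hmu : 0 < mu) {r : ℝ}
    (hr : lam / (lam + mu) < r) (hr1 : r < 1) :
    ∃ C : ℝ, 0 < C ∧ ∀ (T : ℝ≥0) (m : ℕ), P {ω | m ≤ process η ν T ω} ≤
      ENNReal.ofReal (C * r ^ m *
        Real.exp (-((α * T : ℝ≥0) * klFun (max (m / (α * T : ℝ≥0)) 1)))) := by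
  have := (hν 0).isProbabilityMeasure
  have hη_le := hη.ae_le_index hη₀ fun i j hij => not_lt.1 fun hlt =>
    hij (by rw [transProb_of_add_one_lt hlt, ENNReal.ofReal_zero])
  obtain ⟨C, hC, htail⟩ := exists_measure_jumpChain_ge_le hη hη₀ hlam hmu hr hr1
  have hr0 : 0 < r := lt_trans (by positivity) hr
  refine ⟨C, hC, fun T m => ?_⟩
  rw [ENNReal.ofReal_mul (by positivity)]
  exact (measure_le_randomIndex_le (hν T) (hind T) hη_le fun n => htail n m).trans
    (by gcongr; exact poissonMeasure_Ici_le _ _)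

lemma exists_le_measure_process_mem_Icc
    (hη : HasTransitionProb P (fun i j => ENNReal.ofReal (transProb lam mu i j)) η)
    (hη₀ : ∀ᵐ ω ∂P, η 0 ω = 0) (hν : ∀ T, HasLaw (ν T) (poissonMeasure (α * T)) P)
    (hind : ∀ T n, IndepFun (ν T) (η n) P) (hlam : 0 < lam) (hmu : 0 < mu) :
    ∃ M : ℕ, ∀ (T : ℝ≥0) (m n : ℕ), m ≤ n →
      ENNReal.ofReal (2⁻¹ * (lam / (lam + mu)) ^ m * (poissonMeasure (α * T)).real {n}) ≤
        P {ω | process η ν T ω ∈ Set.Icc m (m + M)} := by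
  have := (hν 0).isProbabilityMeasure
  obtain ⟨M, hM⟩ := exists_le_measure_jumpChain_mem_Icc hη hη₀ hlam hmu
  refine ⟨M, fun T m n hmn => ?_⟩
  calc ENNReal.ofReal (2⁻¹ * (lam / (lam + mu)) ^ m * (poissonMeasure (α * T)).real {n})
      = poissonMeasure (α * T) {n} * ENNReal.ofReal ((lam / (lam + mu)) ^ m / 2) := by
        rw [ENNReal.ofReal_mul (by positivity), ofReal_measureReal, mul_comm, inv_mul_eq_div]
    _ ≤ poissonMeasure (α * T) {n} * P {ω | η n ω ∈ Set.Icc m (m + M)} := by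
        gcongr
        exact hM n m hmn
    _ ≤ P {ω | process η ν T ω ∈ Set.Icc m (m + M)} :=
        mul_le_measure_randomIndex_mem (hν T) (hind T) _ n

variable {φ : ℝ≥0 → ℝ} {b : ℝ}

lemma limsup_logMeasureDiv_process_ge_le
    (hη : HasTransitionProb P (fun i j => ENNReal.ofReal (transProb lam mu i j)) η)
    (hη₀ : ∀ᵐ ω ∂P, η 0 ω = 0) (hν : ∀ T, HasLaw (ν T) (poissonMeasure (α * T)) P)
    (hind : ∀ T n, IndepFun (ν T) (η n) P) (hlam : 0 < lam) (hmu : 0 < mu)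
    (hφ : Tendsto φ atTop atTop) (hb : 0 < b)
    (ha : Tendsto (fun T : ℝ≥0 => ((α * T : ℝ≥0) : ℝ) / φ T) atTop (𝓝 b)) {x : ℝ} (hx : 0 ≤ x) :
    limsup (fun T => logMeasureDiv P (φ T) {ω | x ≤ process η ν T ω / φ T}) atTop ≤
      ((-finiteRate (lam / (lam + mu)) b x : ℝ) : EReal) := by
  have hp : 0 < lam / (lam + mu) := by positivity
  have hp1 : lam / (lam + mu) < 1 := (div_lt_one (by positivity)).2 (by linarith)
  have hcont : ContinuousAt (fun r => -finiteRate r b x) (lam / (lam + mu)) := by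
    unfold finiteRate
    have := (Real.continuousAt_log hp.ne').const_mul x
    fun_prop
  have hlim : Tendsto (fun r => ((-finiteRate r b x : ℝ) : EReal)) (𝓝[>] (lam / (lam + mu)))
      (𝓝 ((-finiteRate (lam / (lam + mu)) b x : ℝ) : EReal)) :=
    EReal.tendsto_coe.2 (hcont.tendsto.mono_left nhdsWithin_le_nhds)
  refine ge_of_tendsto hlim ?_
  filter_upwards [Ioo_mem_nhdsGT hp1] with r hr
  obtain ⟨C, hC, htail⟩ := exists_measure_process_ge_le hη hη₀ hν hind hlam hmu hr.1 hr.2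
  exact limsup_logMeasureDiv_le_div_le hφ ha hb hC (hp.trans hr.1) htail hx

end LargeDeviations

end UniformCatastrophes

open UniformCatastrophes in
theorem mainTheorem1_general {Ω : Type*} [MeasurableSpace Ω] {P : Measure Ω} {lam mu : ℝ}
    {α : ℝ≥0} {η : ℕ → Ω → ℕ} {ν : ℝ≥0 → Ω → ℕ} {φ : ℝ≥0 → ℝ} {k : ℝ}
    (hη : HasTransitionProb P (fun i j => ENNReal.ofReal (transProb lam mu i j)) η)
    (hη₀ : ∀ᵐ ω ∂P, η 0 ω = 0) (hν : ∀ T, HasLaw (ν T) (poissonMeasure (α * T)) P)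
    (hind : ∀ T n, IndepFun (ν T) (η n) P) (hlam : 0 < lam) (hmu : 0 < mu) (hα : 0 < α)
    (hk : 0 < k) (hφ : Tendsto (fun T : ℝ≥0 => φ T / (T : ℝ)) atTop (𝓝 k)) :
    SatisfiesLDP P (fun T => scaled (process η ν) φ T 1) φ (rateJ lam mu α k) := by
  have hα' : (0 : ℝ) < α := hα
  have hT : Tendsto ((↑) : ℝ≥0 → ℝ) atTop atTop := NNReal.tendsto_coe_atTop.2 tendsto_id
  have hφ_atTop := tendsto_atTop_of_tendsto_div_pos hT hk hφ
  have hmean : Tendsto (fun T : ℝ≥0 => ((α * T : ℝ≥0) : ℝ) / φ T) atTop (𝓝 (α / k)) := by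
    refine tendsto_div_of_tendsto_div_div hT hk.ne' hφ (tendsto_const_nhds.congr' ?_)
    filter_upwards [hT.eventually_ne_atTop 0] with T hT0
    rw [NNReal.coe_mul, mul_div_cancel_right₀ _ hT0]
  have hrate {x : ℝ} (hx : 0 ≤ x) : -rateJ lam mu α k x =
      ((-finiteRate (lam / (lam + mu)) (α / k) x : ℝ) : EReal) := by
    rw [rateJ_of_nonneg hlam hmu hα' hk hx, EReal.coe_neg]
  obtain ⟨M, hM⟩ := exists_le_measure_process_mem_Icc hη hη₀ hν hind hlam hmu
  refine ⟨hφ_atTop, rateJ_nonneg hlam hmu hα' hk, fun c _ => isCompact_rateJ_le hlam hmu hα' hk c,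
    fun B _ => ?_, fun B _ => ?_⟩ <;> simp only [scaled, mul_one]
  · refine limsup_logMeasureDiv_mem_le (hφ_atTop.eventually_gt_atTop 0) ?_ (fun x hx => ?_) B
    · filter_upwards [hφ_atTop.eventually_ge_atTop 0] with T hφT ω
      positivity
    · rw [hrate hx]
      exact limsup_logMeasureDiv_process_ge_le hη hη₀ hν hind hlam hmu hφ_atTop (by positivity)
        hmean hx
  · refine le_liminf_logMeasureDiv_mem (fun x => rateJ_of_neg) (fun x hx U hU => ?_) B
    rw [hrate hx]
    exact neg_finiteRate_le_liminf_logMeasureDiv hφ_atTop hmean (by positivity) (by positivity)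
      (by positivity) hM hx hU

theorem mainTheorem1 {Ω : Type*} [MeasurableSpace Ω] (P : Measure Ω) [IsProbabilityMeasure P]
    (lam mu : ℝ) (hlam : 0 < lam) (hmu : 0 < mu) (α : ℝ≥0) (hα : 0 < α)
    (ξ : ℝ≥0 → Ω → ℕ) (hξ : UniformCatastrophes.IsPoissonUniformCatastrophes P lam mu α ξ)
    (φ : ℝ≥0 → ℝ) (k : ℝ) (hk : 0 < k)
    (hφ : Tendsto (fun T : ℝ≥0 => φ T / (T : ℝ)) atTop (𝓝 k)) :
    UniformCatastrophes.SatisfiesLDP P (fun T => UniformCatastrophes.scaled ξ φ T 1) φ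
      (UniformCatastrophes.rateJ lam mu α k) := by
  obtain ⟨η, ν, hη, hν, hind, rfl⟩ := hξ
  exact mainTheorem1_general hη.hasTransitionProb hη.initial hν.hasLaw
    (fun T n => hind.comp (measurable_pi_apply T) (measurable_pi_apply n)) hlam hmu hα hk hφ
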